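/- Consider the right-moving massless scalar field (real or complex) for the relativistic black-hole model, in which the incoming coordinate $x$ and the outgoing coordinate $y$ are related by $x(y)=\Delta-e^{-My}$, $y\in\mathbb R$, with $M>0$, $\Delta\in\mathbb R$. Let $\phi$ be the incoming field, with two-point function $(\Omega_o,\phi[g_1]\phi[g_2]^\dagger\Omega_o)=\int_0^\infty\frac{dk}{2k}\,\tilde g_2(k)^*\tilde g_1(k)$ in the incoming vacuum $\Omega_o$, where $\tilde g(k)=(2\pi)^{-1/2}\int e^{-ikx}g(x)\,dx$, and let $\hat\phi(y)=\phi(x(y))$, $\hat\phi[f]=\int f(y)\,\hat\phi(y)\,dy$. Let $\bar N_o[f]=(\Omega_o,\hat\phi[f]^\dagger\hat\phi[f]\,\Omega_o)=\int_0^\infty\frac{dk}{2k}\,\Big|\frac1{\sqrt{2\pi}}\int e^{ikx(y)}f(y)\,dy\Big|^2$ be the mean number of spontaneously created particles, and let $$\bar N^{Th}_{\beta,in}[f]=\frac{\mathrm{Tr}\big[e^{-\beta H_{in}}\,\hat\phi[f]^\dagger\hat\phi[f]\big]}{\mathrm{Tr}\big[e^{-\beta H_{in}}\big]}$$ be the mean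 number of particles in the incoming thermal state of inverse temperature $\beta$. The latter is understood as a limit: one puts the incoming field in a periodic box $0\le x\le L$, keeps only the momenta $k_n=2\pi n/L\le\Lambda$, $n\ge1$, i.e. $\phi(x)=\sum_n(2k_nL)^{-1/2}\big(a_ne^{-ik_nx}+b_n^\dagger e^{ik_nx}\big)$ (with $b_n=a_n$ for the real field), takes the Gibbs mean value in the Fock space of these finitely many modes, and lets $L\to\infty$ and $\Lambda\to\infty$ (joint limit). The difference $\bar N^{Th}_{\beta,in}[f]-\bar N_o[f]$ is understood as the limit of the difference between the Gibbs and vacuum mean values with the same $L,\Lambda$, so that it makes sense even if $\bar N_o[f]=\infty$. **Theorem.** Let $\tilde f\in L^2\big(\frac{dp}{2p},\mathbb R_+\big)$ be a normalized outgoing wave function, $\int_0^\infty\frac{dp}{2p}|\tilde f(p)|^2=1$, whose position-space representative $f(y)$ exists a.e. and is integrable, i.e. $f\in L^1(\mathbb R)$ and $(2\pi)^{-1/2}\int e^{-ipy}f(y)\,dy$ equals $\tilde f(p)$ for a.e. $p>0$ and $0$ for $p<0$. Then for all $\beta>0$ $$\bar N^{Th}_{\beta,in}[f]-\bar N_o[f]=\infty$$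 (and, whenever $\bar N_o[f]<\infty$, this also holds with the value $\bar N_o[f]$ subtracted before the limit is taken). Hence $\bar N^{Th}_{\beta,in}[f]=\infty$ for all $\beta>0$. In particular it is never thermal: for every $\beta'>0$ for which the thermal mean number of outgoing particles $\bar N^{Th}_{\beta',out}[f]=\int_0^\infty\frac{dp}{2p}\,\frac{|\tilde f(p)|^2}{e^{\beta'p}-1}$ is finite, $\bar N^{Th}_{\beta,in}[f]-\bar N^{Th}_{\beta',out}[f]=\infty$. -/

import Mathlib

open MeasureTheory Filter Topology

noncomputable section

namespace RelBH

/-! ### Fourier conventions, wave functions, coordinates -/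

/-- `(2π)^{-1/2} ∫ e^{-i k X(y)} f(y) dy`. For `X = id` this is the (unitary) Fourier transform of
`f`. If `x = X(y)` is the change of coordinates, it is the Fourier transform at incoming momentum
`k` of the incoming test function `f̌`, which is determined by `∫ f̌(x) φ(x) dx = ∫ f(y) φ(X(y)) dy`;
that is, it is `(U f̃)(k)`. -/
def pulledFourier (X : ℝ → ℝ) (f : ℝ → ℂ) (k : ℝ) : ℂ :=
  ((√(2 * Real.pi))⁻¹ : ℝ) * ∫ y, Complex.exp (-(Complex.I * k * X y)) * f y

/-- The measure `dp / (2p)` on `(0, ∞)`. -/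
def waveMeasure : Measure ℝ :=
  (volume.restrict (Set.Ioi 0)).withDensity fun p => ENNReal.ofReal (1 / (2 * p))

/-- The wave function `f̃ ∈ L²(dp/2p, ℝ₊)` is represented in position space by the integrable
function `f`: the Fourier transform of `f` is `f̃` on the positive half-line and vanishes on the
negative one. -/
structure IsPositionSpaceFunction (ft : Lp ℂ 2 waveMeasure) (f : ℝ → ℂ) : Prop where
  integrable : Integrable f
  fourier_pos : ∀ᵐ p ∂waveMeasure, pulledFourier id f p = ft p
  fourier_neg : ∀ p < 0, pulledFourier id f p = 0

/-- Incoming coordinate as a function of the outgoing one, for the relativistic black hole. -/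
def relX (M Δ : ℝ) (y : ℝ) : ℝ := Δ - Real.exp (-M * y)

/-! ### Bosonic Fock space over finitely many modes -/

/-- Finite linear combinations of the occupation-number states `|n⟩`, `n : ι → ℕ`, which form
an orthonormal basis of the Fock space over the modes `ι`. -/
abbrev Fock (ι : Type) := (ι → ℕ) →₀ ℂ

variable {ι : Type} [Fintype ι] [DecidableEq ι]

/-- `a_i |n⟩ = √(n_i) |n - e_i⟩`. -/
def annihilate (i : ι) : Fock ι →ₗ[ℂ] Fock ι :=
  Finsupp.lsum ℂ fun n =>
    ((√(n i : ℝ) : ℝ) : ℂ) • Finsupp.lsingle (Function.update n i (n i - 1))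

/-- `a_i† |n⟩ = √(n_i + 1) |n + e_i⟩`. -/
def create (i : ι) : Fock ι →ₗ[ℂ] Fock ι :=
  Finsupp.lsum ℂ fun n =>
    ((√((n i : ℝ) + 1) : ℝ) : ℂ) • Finsupp.lsingle (Function.update n i (n i + 1))

/-- `∑ i, (u_i a_i + v_i a_i†)`. -/
def linearField (u v : ι → ℂ) : Fock ι →ₗ[ℂ] Fock ι :=
  ∑ i, (u i • annihilate i + v i • create i)

/-- `Φ† Φ` for `Φ = ∑ i, (u_i a_i + v_i a_i†)`. -/
def fieldSquare (u v : ι → ℂ) : Fock ι →ₗ[ℂ] Fock ι :=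
  linearField (fun i => star (v i)) (fun i => star (u i)) ∘ₗ linearField u v

/-- Diagonal matrix element `⟨n| A |n⟩`. -/
def diagElem (A : Fock ι →ₗ[ℂ] Fock ι) (n : ι → ℕ) : ℂ := A (Finsupp.single n 1) n

/-- Eigenvalue on `|n⟩` of the Hamiltonian `H = ∑ i, ε_i a_i† a_i`. -/
def energy (ε : ι → ℝ) (n : ι → ℕ) : ℝ := ∑ i, ε i * n i

/-- `Tr (e^{-βH} A) / Tr (e^{-βH})`. -/
def gibbsMean (β : ℝ) (ε : ι → ℝ) (A : Fock ι →ₗ[ℂ] Fock ι) : ℂ :=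
  (∑' n : ι → ℕ, (Real.exp (-β * energy ε n) : ℂ) * diagElem A n) /
    ∑' n : ι → ℕ, (Real.exp (-β * energy ε n) : ℂ)

/-- The mean value of `A` in the vacuum `|0⟩`. -/
def vacuumMean (A : Fock ι →ₗ[ℂ] Fock ι) : ℂ := diagElem A 0

/-! ### The incoming right-moving massless field in a box, with a momentum cutoff

The incoming coordinate is periodic of period `L`, and only the modes of momentum
`k_j = 2π (j + 1) / L ≤ Λ` are kept. The field is
`φ(x) = ∑ j, (2 k_j L)^{-1/2} (a_j e^{-i k_j x} + b_j† e^{i k_j x})`,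
with `b = a` for the real field and with independent `a`, `b` for the complex one, and
`φ̂(y) = φ(X(y))`. -/

inductive ScalarField
  | real
  | complex

def modeCount (L Λ : ℝ) : ℕ := ⌊Λ * L / (2 * Real.pi)⌋₊

def momentum (L : ℝ) (j : ℕ) : ℝ := 2 * Real.pi * ((j : ℝ) + 1) / L

/-- Coefficient of `a_j` in `∫ f(y) φ(X(y)) dy`. -/
def coeffA (X : ℝ → ℝ) (f : ℝ → ℂ) (L : ℝ) (j : ℕ) : ℂ :=
  ((√(2 * momentum L j * L))⁻¹ : ℝ) *
    ∫ y, f y * Complex.exp (-(Complex.I * momentum L j * X y))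

/-- Coefficient of `b_j†` in `∫ f(y) φ(X(y)) dy`. -/
def coeffB (X : ℝ → ℝ) (f : ℝ → ℂ) (L : ℝ) (j : ℕ) : ℂ :=
  ((√(2 * momentum L j * L))⁻¹ : ℝ) *
    ∫ y, f y * Complex.exp (Complex.I * momentum L j * X y)

/-- `φ̂[f]† φ̂[f]` for the real field. -/
def numberOpReal (X : ℝ → ℝ) (f : ℝ → ℂ) (L Λ : ℝ) :
    Fock (Fin (modeCount L Λ)) →ₗ[ℂ] Fock (Fin (modeCount L Λ)) :=
  fieldSquare (fun j => coeffA X f L j) (fun j => coeffB X f L j)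

/-- `φ̂[f]† φ̂[f]` for the complex field; `Sum.inl` labels particles and `Sum.inr`
antiparticles. -/
def numberOpComplex (X : ℝ → ℝ) (f : ℝ → ℂ) (L Λ : ℝ) :
    Fock (Fin (modeCount L Λ) ⊕ Fin (modeCount L Λ)) →ₗ[ℂ]
      Fock (Fin (modeCount L Λ) ⊕ Fin (modeCount L Λ)) :=
  fieldSquare (Sum.elim (fun j => coeffA X f L j) (fun _ => 0))
    (Sum.elim (fun _ => 0) (fun j => coeffB X f L j))

/-- Mean value of `φ̂[f]† φ̂[f]` in the incoming thermal state of inverse temperature `β`, in the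
box of length `L` and with momentum cutoff `Λ`. -/
def thermalNumber (s : ScalarField) (X : ℝ → ℝ) (f : ℝ → ℂ) (β L Λ : ℝ) : ℝ :=
  match s with
  | .real =>
      (gibbsMean β (fun j : Fin (modeCount L Λ) => momentum L j) (numberOpReal X f L Λ)).re
  | .complex =>
      (gibbsMean β (Sum.elim (fun j : Fin (modeCount L Λ) => momentum L j)
        (fun j : Fin (modeCount L Λ) => momentum L j)) (numberOpComplex X f L Λ)).re

/-- Mean value of `φ̂[f]† φ̂[f]` in the incoming vacuum, in the same box and with the same
cutoff. -/
def vacuumNumber (s : ScalarField) (X : ℝ → ℝ) (f : ℝ → ℂ) (L Λ : ℝ) : ℝ :=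
  match s with
  | .real => (vacuumMean (numberOpReal X f L Λ)).re
  | .complex => (vacuumMean (numberOpComplex X f L Λ)).re

/-- Removal of the two cutoffs: `L → ∞` and `Λ → ∞`, independently. -/
def cutoffRemoval : Filter (ℝ × ℝ) := atTop ×ˢ atTop

/-- `N̄^{Th}_{β,in}[f] = ν`, the thermal mean value being defined as a limit. -/
def ThermalNumberEq (s : ScalarField) (X : ℝ → ℝ) (f : ℝ → ℂ) (β : ℝ) (ν : EReal) : Prop :=
  Tendsto (fun c : ℝ × ℝ => (thermalNumber s X f β c.1 c.2 : EReal)) cutoffRemoval (𝓝 ν)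

/-- `N̄^{Th}_{β,in}[f] - N̄_o[f] = ν`. The subtraction is made before the cutoffs are removed, since
both terms may diverge. -/
def ExcessNumberEq (s : ScalarField) (X : ℝ → ℝ) (f : ℝ → ℂ) (β : ℝ) (ν : EReal) : Prop :=
  Tendsto
    (fun c : ℝ × ℝ => ((thermalNumber s X f β c.1 c.2 - vacuumNumber s X f c.1 c.2 : ℝ) : EReal))
    cutoffRemoval (𝓝 ν)

/-! ### Quantities without cutoffs -/

/-- `N̄_o[f] = ∫_0^∞ dk/(2k) |(U f̃)(-k)|²`, the mean number of spontaneously created particles. -/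
def spontaneousNumber (X : ℝ → ℝ) (f : ℝ → ℂ) : ENNReal :=
  ∫⁻ k, ‖pulledFourier X f (-k)‖ₑ ^ 2 ∂waveMeasure

/-- `N̄^{Th}_{β,out}[f] = ∫_0^∞ dp/(2p) |f̃(p)|² / (e^{βp} - 1)`, the thermal mean number of
outgoing particles. -/
def outgoingThermalNumber (β : ℝ) (ft : Lp ℂ 2 waveMeasure) : ENNReal :=
  ∫⁻ p, ‖ft p‖ₑ ^ 2 * ENNReal.ofReal (1 / (Real.exp (β * p) - 1)) ∂waveMeasure

end RelBH

end

open MeasureTheory Filter Topology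

noncomputable section

namespace RelBH

/-! ### Gibbs mean values of field squares -/

section Gibbs

/-! The divergence is infrared. By the Bose–Einstein distribution (`gibbsMean_fieldSquare`) the
thermal excess in the box is a Riemann sum of `excessDensity`, up to a factor. With `F` the Fourier
transform of `f` in the incoming coordinate, this density behaves like `(|F k|² + |F (-k)|²) / (β
k²)` near `k = 0`. By Fatou it suffices that its integral over `(0, 1]` is infinite.

Suppose it is finite. Then `F k / k` is in `L²(ℝ)`. Pairing with a test function of `r = exp (-M y)`
dilated by `m²` then gives `O(m)` (`norm_schwartz_comp_integral_le`). Dilations in `r` are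
translations in `y`, so `S t = ∫ f y * φ (y - t)` is `O(exp (M t / 2))` for every test function `φ`.
But `f` has only positive frequencies, so `S` is the boundary value of a bounded holomorphic
function on a half-plane. Exponential decay along half of the boundary line forces `S 0 = 0`, by
Phragmén–Lindelöf (`eq_zero_of_exp_decay_on_imaginary_axis`). As `φ` is arbitrary, `f = 0` a.e.,
against the normalization. -/

theorem annihilate_single {ι : Type} [DecidableEq ι] (i : ι) (n : ι → ℕ) (c : ℂ) :
    annihilate i (Finsupp.single n c) =
      Finsupp.single (Function.update n i (n i - 1)) (((√(n i : ℝ) : ℝ) : ℂ) * c) := by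
  simp [annihilate]

theorem create_single {ι : Type} [DecidableEq ι] (i : ι) (n : ι → ℕ) (c : ℂ) :
    create i (Finsupp.single n c) =
      Finsupp.single (Function.update n i (n i + 1)) (((√((n i : ℝ) + 1) : ℝ) : ℂ) * c) := by
  simp [create]

theorem annihilate_annihilate_diag {ι : Type} [Fintype ι] [DecidableEq ι] (i j : ι) (n : ι → ℕ) :
    annihilate j (annihilate i (Finsupp.single n 1)) n = 0 := by
  rw [annihilate_single, annihilate_single, Finsupp.single_apply]
  split_ifs with h
  -- Truncated subtraction can return the same state when `n i = 0`; the coefficient `√0` then kills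
  -- the term.
  · rcases Nat.eq_zero_or_pos (n i) with h0 | h0
    · simp [h0]
    · have h1 := congr_fun h i
      by_cases hij : i = j
      · subst hij; simp at h1; omega
      · simp [hij] at h1; omega
  · rfl

theorem create_create_diag {ι : Type} [Fintype ι] [DecidableEq ι] (i j : ι) (n : ι → ℕ) :
    create j (create i (Finsupp.single n 1)) n = 0 := by
  rw [create_single, create_single, Finsupp.single_apply]
  split_ifs with h
  · have h1 := congr_fun h i
    by_cases hij : i = j
    · subst hij; simp at h1; omega
    · simp [hij] at h1
  · rfl

theorem create_annihilate_diag {ι : Type} [Fintype ι] [DecidableEq ι] (i j : ι) (n : ι → ℕ) :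
    create j (annihilate i (Finsupp.single n 1)) n = if j = i then (n i : ℂ) else 0 := by
  rw [annihilate_single, create_single, Finsupp.single_apply]
  rcases Nat.eq_zero_or_pos (n i) with h0 | h0
  · simp [h0]
  by_cases hij : j = i
  · subst hij
    have h1 : n j - 1 + 1 = n j := by omega
    have h2 : ((n j - 1 : ℕ) : ℝ) + 1 = n j := by exact_mod_cast h1
    simp only [Function.update_self, Function.update_idem, h1, Function.update_eq_self, if_true,
      mul_one, h2]
    rw [← Complex.ofReal_mul, Real.mul_self_sqrt (Nat.cast_nonneg _)]
    simp
  · rw [if_neg, if_neg hij]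
    intro h
    have h1 := congr_fun h i
    simp [Ne.symm hij] at h1
    omega

theorem annihilate_create_diag {ι : Type} [Fintype ι] [DecidableEq ι] (i j : ι) (n : ι → ℕ) :
    annihilate j (create i (Finsupp.single n 1)) n = if j = i then ((n i : ℂ) + 1) else 0 := by
  rw [create_single, annihilate_single, Finsupp.single_apply]
  by_cases hij : j = i
  · subst hij
    simp only [Function.update_self, Function.update_idem, Nat.add_sub_cancel,
      Function.update_eq_self, if_true, mul_one, Nat.cast_add, Nat.cast_one]
    rw [← Complex.ofReal_mul, Real.mul_self_sqrt (by positivity)]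
    simp
  · rw [if_neg, if_neg hij]
    intro h
    have h1 := congr_fun h i
    simp [Ne.symm hij] at h1

/-- Only the products `a_i† a_i` and `a_i a_i†` preserve all occupation numbers; they give `n i` and
`n i + 1`. -/
theorem diagElem_fieldSquare {ι : Type} [Fintype ι] [DecidableEq ι] (u v : ι → ℂ) (n : ι → ℕ) :
    diagElem (fieldSquare u v) n =
      ((∑ i, (‖u i‖ ^ 2 * n i + ‖v i‖ ^ 2 * (n i + 1)) : ℝ) : ℂ) := by
  simp only [diagElem, fieldSquare, linearField, LinearMap.comp_apply, LinearMap.sum_apply,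
    LinearMap.add_apply, LinearMap.smul_apply, map_sum, map_add, map_smul, Finsupp.coe_finsetSum,
    Finsupp.coe_add, Finsupp.coe_smul, Finset.sum_apply, Pi.add_apply, Pi.smul_apply, smul_eq_mul,
    annihilate_annihilate_diag, create_create_diag, create_annihilate_diag,
    annihilate_create_diag, mul_zero, add_zero, zero_add, mul_ite]
  push_cast
  refine Finset.sum_congr rfl fun i _ => ?_
  simp only [Finset.sum_ite_eq', Finset.mem_univ, if_true]
  have h1 : (‖u i‖ ^ 2 : ℂ) = u i * star (u i) := by simp [Complex.mul_conj']
  have h2 : (‖v i‖ ^ 2 : ℂ) = v i * star (v i) := by simp [Complex.mul_conj']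
  rw [h1, h2]
  ring

theorem vacuumMean_fieldSquare {ι : Type} [Fintype ι] [DecidableEq ι] (u v : ι → ℂ) :
    (vacuumMean (fieldSquare u v)).re = ∑ i, ‖v i‖ ^ 2 := by
  rw [vacuumMean, diagElem_fieldSquare, Complex.ofReal_re]
  simp

/-- A product of nonnegative summable functions of the individual occupation numbers is
summable. -/
theorem summable_prod_pi {ι : Type} [Fintype ι] [DecidableEq ι] {g : ι → ℕ → ℝ} (hg0 : ∀ i m, 0 ≤ g i m) (hg : ∀ i, Summable (g i)) :
    Summable fun n : ι → ℕ => ∏ i, g i (n i) := by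
  refine summable_of_sum_le (c := ∏ i, ∑' m, g i m)
    (fun n => Finset.prod_nonneg fun i _ => hg0 i _) fun u => ?_
  have hsub : u ⊆ Fintype.piFinset fun i => u.image fun n => n i := fun n hn => by
    simp only [Fintype.mem_piFinset]
    exact fun i => Finset.mem_image_of_mem _ hn
  calc ∑ n ∈ u, ∏ i, g i (n i)
      ≤ ∑ n ∈ Fintype.piFinset fun i => u.image fun n => n i, ∏ i, g i (n i) :=
        Finset.sum_le_sum_of_subset_of_nonneg hsub
          fun n _ _ => Finset.prod_nonneg fun i _ => hg0 i _
    _ = ∏ i, ∑ m ∈ u.image fun n => n i, g i m := (Finset.prod_univ_sum _ _).symm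
    _ ≤ ∏ i, ∑' m, g i m :=
        Finset.prod_le_prod (fun i _ => Finset.sum_nonneg fun m _ => hg0 i m)
          fun i _ => (hg i).sum_le_tsum _ fun m _ => hg0 i m

theorem exp_neg_energy {ι : Type} [Fintype ι] (β : ℝ) (ε : ι → ℝ) (n : ι → ℕ) :
    Real.exp (-β * energy ε n) = ∏ i, Real.exp (-β * ε i) ^ n i := by
  rw [energy, Finset.mul_sum, Real.exp_sum]
  refine Finset.prod_congr rfl fun i _ => ?_
  rw [← Real.exp_nat_mul]
  ring_nf

theorem exp_neg_mul_lt_one {ι : Type} {β : ℝ} {ε : ι → ℝ} (hβ : 0 < β) (hε : ∀ i, 0 < ε i) (i : ι) :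
    Real.exp (-β * ε i) < 1 := by
  rw [Real.exp_lt_one_iff]
  nlinarith [mul_pos hβ (hε i)]

theorem summable_exp_neg_energy {ι : Type} [Fintype ι] [DecidableEq ι] {β : ℝ}
    {ε : ι → ℝ} (hβ : 0 < β) (hε : ∀ i, 0 < ε i) :
    Summable fun n => Real.exp (-β * energy ε n) := by
  simp only [exp_neg_energy]
  exact summable_prod_pi (g := fun i m => Real.exp (-β * ε i) ^ m) (fun i m => by positivity)
    fun i => summable_geometric_of_lt_one (Real.exp_pos _).le (exp_neg_mul_lt_one hβ hε i)

theorem summable_exp_neg_energy_mul {ι : Type} [Fintype ι] [DecidableEq ι] {β : ℝ}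
    {ε : ι → ℝ} (hβ : 0 < β) (hε : ∀ i, 0 < ε i) (i : ι) :
    Summable fun n => Real.exp (-β * energy ε n) * n i := by
  have h := summable_prod_pi
    (g := fun j m => Real.exp (-β * ε j) ^ m * if j = i then (m : ℝ) else 1)
    (fun j m => by split_ifs <;> positivity) fun j => by
      have hq := exp_neg_mul_lt_one hβ hε j
      split_ifs
      · simpa [mul_comm] using summable_pow_mul_geometric_of_norm_lt_one 1
          (by simpa [abs_of_pos (Real.exp_pos _)] using hq)
      · simpa using summable_geometric_of_lt_one (Real.exp_pos _).le hq
  refine h.congr fun n => ?_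
  rw [Finset.prod_mul_distrib, exp_neg_energy]
  simp

/-- The Bose–Einstein distribution: `∑ n_i e^{-βE} = (e^{βε_i} - 1)⁻¹ ∑ e^{-βE}`. -/
theorem tsum_exp_neg_energy_mul {ι : Type} [Fintype ι] [DecidableEq ι] {β : ℝ}
    {ε : ι → ℝ} (hβ : 0 < β) (hε : ∀ i, 0 < ε i) (i : ι) :
    ∑' n, Real.exp (-β * energy ε n) * n i =
      (Real.exp (β * ε i) - 1)⁻¹ * ∑' n, Real.exp (-β * energy ε n) := by
  set q := Real.exp (-β * ε i) with hq
  have hq1 : q < 1 := exp_neg_mul_lt_one hβ hε i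
  have hS := summable_exp_neg_energy_mul hβ hε i
  have hZ := summable_exp_neg_energy hβ hε
  -- Terms with `n i = 0` vanish, so reindexing by `n ↦ n + e_i` gives `S = q (S + Z)`, which is
  -- solved for `S`.
  let sh : (ι → ℕ) → (ι → ℕ) := fun n => Function.update n i (n i + 1)
  have hinj : Function.Injective sh := fun m n h => by
    ext j
    have hj := congr_fun h j
    by_cases hji : j = i
    · subst hji; simpa [sh] using hj
    · simpa [sh, hji] using hj
  have hsupp : Function.support (fun n : ι → ℕ => Real.exp (-β * energy ε n) * n i) ⊆
      Set.range sh := fun n hn => by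
    have h0 : n i ≠ 0 := fun h => hn (by simp [h])
    refine ⟨Function.update n i (n i - 1), ?_⟩
    have h1 : n i - 1 + 1 = n i := by omega
    simp [sh, h1]
  have hE : ∀ n, energy ε (sh n) = energy ε n + ε i := fun n => by
    have : ∀ j, ε j * (sh n j : ℝ) = ε j * n j + if j = i then ε i else 0 := fun j => by
      by_cases hji : j = i
      · subst hji; simp [sh]; ring
      · simp [sh, hji]
    simp only [energy, this, Finset.sum_add_distrib, Finset.sum_ite_eq', Finset.mem_univ, if_true]
  have key : ∑' n, Real.exp (-β * energy ε n) * n i =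
      q * (∑' n, Real.exp (-β * energy ε n) * n i + ∑' n, Real.exp (-β * energy ε n)) := by
    rw [← hS.tsum_add hZ, ← tsum_mul_left]
    conv_lhs => rw [← hinj.tsum_eq hsupp]
    refine tsum_congr fun n => ?_
    rw [hE, mul_add, Real.exp_add]
    simp [sh, hq]
    ring
  have hqe : Real.exp (β * ε i) = q⁻¹ := by rw [hq, ← Real.exp_neg]; ring_nf
  have hq0 : 0 < q := Real.exp_pos _
  rw [hqe]
  have h1q : 1 - q ≠ 0 := by linarith
  generalize ∑' n, Real.exp (-β * energy ε n) * n i = S at key ⊢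
  generalize ∑' n, Real.exp (-β * energy ε n) = Z at key ⊢
  field_simp
  linear_combination key

/-- The first sum is the vacuum mean, so the excess is the second sum, whose terms are all
nonnegative. -/
theorem gibbsMean_fieldSquare {ι : Type} [Fintype ι] [DecidableEq ι] {β : ℝ}
    {ε : ι → ℝ} (hβ : 0 < β) (hε : ∀ i, 0 < ε i) (u v : ι → ℂ) :
    (gibbsMean β ε (fieldSquare u v)).re = ∑ i, ‖v i‖ ^ 2 +
      ∑ i, (‖u i‖ ^ 2 + ‖v i‖ ^ 2) * (Real.exp (β * ε i) - 1)⁻¹ := by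
  have hZ := summable_exp_neg_energy hβ hε
  set Z := ∑' n, Real.exp (-β * energy ε n) with hZdef
  have hZpos : 0 < Z := hZ.tsum_pos (fun _ => (Real.exp_pos _).le) 0 (Real.exp_pos _)
  have hnum : ∑' n, Real.exp (-β * energy ε n) *
      ∑ i, (‖u i‖ ^ 2 * n i + ‖v i‖ ^ 2 * (n i + 1)) =
      ∑ i, ((‖u i‖ ^ 2 + ‖v i‖ ^ 2) * ((Real.exp (β * ε i) - 1)⁻¹ * Z) + ‖v i‖ ^ 2 * Z) := by
    have h1 : ∀ n : ι → ℕ, Real.exp (-β * energy ε n) *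
        ∑ i, (‖u i‖ ^ 2 * n i + ‖v i‖ ^ 2 * (n i + 1)) =
        ∑ i, ((‖u i‖ ^ 2 + ‖v i‖ ^ 2) * (Real.exp (-β * energy ε n) * n i) +
          ‖v i‖ ^ 2 * Real.exp (-β * energy ε n)) := fun n => by
      rw [Finset.mul_sum]
      exact Finset.sum_congr rfl fun i _ => by ring
    have h2 := fun i => (summable_exp_neg_energy_mul hβ hε i).mul_left (‖u i‖ ^ 2 + ‖v i‖ ^ 2)
    have h3 := fun i => hZ.mul_left (‖v i‖ ^ 2)
    simp only [h1]
    rw [Summable.tsum_finsetSum fun i _ => (h2 i).add (h3 i)]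
    refine Finset.sum_congr rfl fun i _ => ?_
    rw [(h2 i).tsum_add (h3 i), tsum_mul_left, tsum_mul_left, tsum_exp_neg_energy_mul hβ hε]
  have : gibbsMean β ε (fieldSquare u v) = (((∑' n, Real.exp (-β * energy ε n) *
      ∑ i, (‖u i‖ ^ 2 * n i + ‖v i‖ ^ 2 * (n i + 1))) / Z : ℝ) : ℂ) := by
    simp only [gibbsMean, diagElem_fieldSquare, ← Complex.ofReal_mul, ← Complex.ofReal_tsum,
      ← hZdef, Complex.ofReal_div]
  rw [this, Complex.ofReal_re, hnum, Finset.sum_add_distrib, ← Finset.sum_mul, add_div,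
    mul_div_cancel_right₀ _ hZpos.ne', add_comm, Finset.sum_div]
  congr 1
  refine Finset.sum_congr rfl fun i _ => ?_
  field_simp

end Gibbs

/-! ### A uniqueness theorem of Phragmén–Lindelöf type -/

section PhragmenLindelof

open Complex

theorem norm_exp_log_weight (κ : ℝ) (w : ℂ) :
    ‖exp (-(κ * (w * log (1 + w))) - κ * Real.pi / 2 * (I * w))‖ =
      Real.exp (κ * (w.im * arg (1 + w) - w.re * Real.log ‖1 + w‖ + Real.pi / 2 * w.im)) := by
  rw [norm_exp]
  congr 1
  have h1 : (-(κ * (w * log (1 + w))) - κ * Real.pi / 2 * (I * w) : ℂ) =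
      ((-κ : ℝ) : ℂ) * (w * log (1 + w)) - ((κ * Real.pi / 2 : ℝ) : ℂ) * (I * w) := by
    push_cast; ring
  rw [h1, sub_re, re_ofReal_mul, re_ofReal_mul, mul_re, log_re, log_im]
  simp
  ring

/-- A bounded holomorphic function on the right half-plane, continuous up to the boundary, that
decays exponentially along one half of the imaginary axis vanishes at the origin. -/
theorem eq_zero_of_exp_decay_on_imaginary_axis {H : ℂ → ℂ}
    (hd : DiffContOnCl ℂ H {z | 0 < z.re}) {C : ℝ} (hC : ∀ z : ℂ, 0 ≤ z.re → ‖H z‖ ≤ C)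
    {D c : ℝ} (hc : 0 < c) (hdec : ∀ s : ℝ, 0 < s → ‖H (s * I)‖ ≤ D * Real.exp (-c * s)) :
    H 0 = 0 := by
  set κ := c / Real.pi with hκ
  have hκ0 : 0 < κ := div_pos hc Real.pi_pos
  have hκπ : κ * Real.pi = c := div_mul_cancel₀ _ Real.pi_pos.ne'
  -- The factor `w log (1 + w)` makes `H * W` decay superexponentially on the positive real axis. It
  -- costs at most `exp (κ π |s| / 2)` at `s * I`. The linear term moves this cost to `s > 0`, where
  -- the total `exp (κ π s) = exp (c s)` is paid for by the decay of `H`. Also `W 0 = 1`.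
  let W : ℂ → ℂ := fun w => exp (-(κ * (w * log (1 + w))) - κ * Real.pi / 2 * (I * w))
  have hWn : ∀ w, ‖W w‖ = _ := norm_exp_log_weight κ
  have hC0 : 0 ≤ C := (norm_nonneg _).trans (hC 0 le_rfl)
  have hWd : DiffContOnCl ℂ W {z | 0 < z.re} := by
    refine DifferentiableOn.diffContOnCl fun z hz => DifferentiableAt.differentiableWithinAt ?_
    have hz' : 0 ≤ z.re := by rwa [closure_setOfPred_lt_re] at hz
    have : 1 + z ∈ slitPlane := Or.inl (by simp; linarith)
    have hl : DifferentiableAt ℂ (fun w : ℂ => log (1 + w)) z :=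
      ((differentiableAt_const _).add differentiableAt_id).clog this
    fun_prop
  have harg : ∀ w : ℂ, 0 ≤ w.re → w.im * arg (1 + w) ≤ |w.im| * (Real.pi / 2) := fun w hw =>
    calc _ ≤ |w.im * arg (1 + w)| := le_abs_self _
      _ ≤ _ := by
        rw [abs_mul]; gcongr
        exact abs_arg_le_pi_div_two_iff.2 (by simp; linarith)
  have hlog : ∀ w : ℂ, 0 ≤ w.re → Real.log (1 + w.re) ≤ Real.log ‖1 + w‖ := fun w hw => by
    refine Real.log_le_log (by linarith) ?_
    simpa using re_le_norm (1 + w)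
  have hlog0 : ∀ w : ℂ, 0 ≤ w.re → 0 ≤ w.re * Real.log ‖1 + w‖ := fun w hw =>
    mul_nonneg hw ((Real.log_nonneg (by linarith)).trans (hlog w hw))
  have hzero := PhragmenLindelof.eq_zero_on_right_half_plane_of_superexponential_decay
    (f := fun w => H w * W w) (by simpa [smul_eq_mul] using hd.smul hWd) ?_ ?_ ?_
  · have h0 := hzero (show (0 : ℂ) ∈ {z : ℂ | 0 ≤ z.re} by simp)
    simpa [W] using h0
  · refine ⟨1, by norm_num, κ * Real.pi, Asymptotics.IsBigO.of_bound C ?_⟩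
    filter_upwards [mem_inf_of_right (mem_principal_self _)] with z hz
    have hz' : 0 ≤ z.re := le_of_lt hz
    rw [norm_mul, Real.rpow_one, Real.norm_of_nonneg (Real.exp_pos _).le, hWn, mul_assoc κ]
    refine mul_le_mul (hC z hz') (Real.exp_le_exp.2 ?_) (Real.exp_pos _).le hC0
    gcongr
    have h1 := harg z hz'
    have h2 := hlog0 z hz'
    have h3 := abs_im_le_norm z
    nlinarith [Real.pi_pos, le_abs_self z.im]
  · intro n
    have hlim : Tendsto (fun x : ℝ => C * Real.exp (x * (n - κ * Real.log (1 + x))))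
        atTop (𝓝 (C * 0)) := by
      refine (Real.tendsto_exp_atBot.comp ?_).const_mul C
      refine tendsto_id.atTop_mul_atBot₀ ?_
      refine tendsto_atBot_add_const_left _ _ (tendsto_neg_atTop_atBot.comp ?_)
      exact (Real.tendsto_log_atTop.comp
        (tendsto_atTop_add_const_left _ _ tendsto_id)).const_mul_atTop hκ0
    rw [mul_zero] at hlim
    refine squeeze_zero' (Eventually.of_forall fun x => by positivity) ?_ hlim
    filter_upwards [eventually_ge_atTop 0] with x hx
    have hx1 : ‖(1 : ℂ) + x‖ = 1 + x := by
      rw [← ofReal_one, ← ofReal_add, norm_real, Real.norm_of_nonneg (by linarith)]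
    rw [norm_mul, hWn, ← Real.exp_nat_mul, ofReal_im, ofReal_re, hx1]
    calc _ ≤ Real.exp (n * x) * (C * Real.exp (κ * (0 * arg (1 + (x : ℂ)) -
          x * Real.log (1 + x) + Real.pi / 2 * 0))) := by
          gcongr
          exact hC x (by simpa using hx)
      _ = _ := by
          rw [mul_left_comm, ← Real.exp_add]
          ring_nf
  · refine ⟨max C D, fun x => ?_⟩
    rw [norm_mul, hWn]
    have him : ((x : ℂ) * I).im = x := by simp
    have hre : ((x : ℂ) * I).re = 0 := by simp
    have h1 := harg (x * I) hre.ge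
    rw [him] at h1
    rw [hre, him, zero_mul, sub_zero]
    rcases le_or_gt x 0 with hx | hx
    · rw [abs_of_nonpos hx] at h1
      calc _ ≤ C * 1 := by
            refine mul_le_mul (hC _ hre.ge) ?_ (Real.exp_pos _).le hC0
            rw [Real.exp_le_one_iff]
            exact mul_nonpos_of_nonneg_of_nonpos hκ0.le (by linarith)
        _ ≤ _ := by simp
    · rw [abs_of_pos hx] at h1
      calc _ ≤ D * Real.exp (-c * x) * Real.exp (c * x) := by
            refine mul_le_mul (hdec x hx) (Real.exp_le_exp.2 ?_) (Real.exp_pos _).le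
              ((norm_nonneg _).trans (hdec x hx))
            rw [← hκπ, mul_assoc]
            gcongr
            linarith
        _ = D := by rw [mul_assoc, ← Real.exp_add]; simp
        _ ≤ _ := le_max_right _ _

end PhragmenLindelof

/-! ### Fourier integrals of pulled-back test functions -/

section Fourier

open scoped FourierTransform

variable {f : ℝ → ℂ}

theorem norm_exp_neg_I_mul (k x : ℝ) : ‖Complex.exp (-(Complex.I * k * x))‖ = 1 := by
  have : -(Complex.I * k * x) = ((-(k * x) : ℝ) : ℂ) * Complex.I := by push_cast; ring
  rw [this, Complex.norm_exp_ofReal_mul_I]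

theorem norm_pulledFourier_le (X : ℝ → ℝ) (k : ℝ) :
    ‖pulledFourier X f k‖ ≤ (√(2 * Real.pi))⁻¹ * ∫ y, ‖f y‖ := by
  rw [pulledFourier, norm_mul, Complex.norm_real, Real.norm_of_nonneg (by positivity)]
  gcongr
  refine (norm_integral_le_integral_norm _).trans_eq (integral_congr_ae ?_)
  filter_upwards with y
  rw [norm_mul, norm_exp_neg_I_mul, one_mul]

theorem continuous_pulledFourier (hf : Integrable f) {X : ℝ → ℝ} (hX : Measurable X) :
    Continuous (pulledFourier X f) := by
  refine continuous_const.mul (continuous_of_dominated (bound := fun y => ‖f y‖) ?_ ?_ hf.norm ?_)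
  · intro k
    exact (by fun_prop : Measurable fun y =>
      Complex.exp (-(Complex.I * k * X y))).aestronglyMeasurable.mul hf.1
  · intro k
    filter_upwards with y
    rw [norm_mul, norm_exp_neg_I_mul, one_mul]
  · filter_upwards with y
    fun_prop

theorem pulledFourier_sub_const (X : ℝ → ℝ) (t k : ℝ) :
    pulledFourier (fun y => X y - t) f k =
      Complex.exp (Complex.I * k * t) * pulledFourier X f k := by
  simp only [pulledFourier]
  rw [mul_left_comm, ← integral_const_mul (Complex.exp _)]
  congr 1
  refine integral_congr_ae (.of_forall fun y => ?_)
  simp only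
  rw [← mul_assoc, ← Complex.exp_add]
  congr 2
  push_cast
  ring

theorem pulledFourier_const_mul (X : ℝ → ℝ) (r k : ℝ) :
    pulledFourier (fun y => r * X y) f k = pulledFourier X f (r * k) := by
  simp only [pulledFourier]
  congr 1
  refine integral_congr_ae (.of_forall fun y => ?_)
  simp only
  congr 2
  push_cast
  ring

/-- Fourier inversion for `φ`, followed by Fubini. -/
theorem integral_mul_schwartz_comp (hf : Integrable f) {X : ℝ → ℝ} (hX : Measurable X)
    (φ : SchwartzMap ℝ ℂ) :
    ∫ y, f y * φ (X y) =
      √(2 * Real.pi) * ∫ ξ, 𝓕 φ ξ * pulledFourier X f (-(2 * Real.pi * ξ)) := by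
  have hinv : ∀ x, φ x = ∫ ξ, Complex.exp (-(Complex.I * (-(2 * Real.pi * ξ) : ℝ) * x)) * 𝓕 φ ξ := by
    intro x
    conv_lhs => rw [← FourierTransform.fourierInv_fourier_eq (F := SchwartzMap ℝ ℂ) φ]
    rw [SchwartzMap.fourierInv_coe, Real.fourierInv_eq']
    congr 1
    ext ξ
    rw [smul_eq_mul]
    congr 2
    simp only [RCLike.inner_apply, conj_trivial]
    push_cast
    ring
  have hint : Integrable (Function.uncurry fun y ξ =>
      f y * (Complex.exp (-(Complex.I * (-(2 * Real.pi * ξ) : ℝ) * X y)) * 𝓕 φ ξ))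
      (volume.prod volume) := by
    have h1 := hf.mul_prod (𝓕 φ).integrable (μ := volume) (ν := volume)
    refine (h1.bdd_mul (c := 1) (f := fun z : ℝ × ℝ =>
      Complex.exp (-(Complex.I * (-(2 * Real.pi * z.2) : ℝ) * X z.1)))
      (by fun_prop : Measurable _).aestronglyMeasurable ?_).congr ?_
    · filter_upwards with z
      rw [norm_exp_neg_I_mul]
    · filter_upwards with z
      simp only [Function.uncurry]
      ring
  simp_rw [hinv, ← integral_const_mul]
  rw [integral_integral_swap hint]
  congr 1
  ext ξ
  rw [pulledFourier, mul_left_comm, ← mul_assoc (↑√(2 * Real.pi) : ℂ), ← Complex.ofReal_mul,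
    mul_inv_cancel₀ (by positivity), Complex.ofReal_one, one_mul, ← integral_const_mul]
  congr 1
  ext y
  ring

/-- A test function of `y` as a test function of `exp (-M y)`. -/
theorem exists_schwartz_comp_exp {M : ℝ} (hM : 0 < M) {φ : ℝ → ℝ} (hφ : ContDiff ℝ (⊤ : ℕ∞) φ)
    (hc : HasCompactSupport φ) :
    ∃ Ψ : SchwartzMap ℝ ℂ, ∀ y, Ψ (Real.exp (-M * y)) = (φ y : ℂ) := by
  -- Compact support of `φ` keeps the support of `Ψ` away from `0`, so extension by zero is smooth.
  let Ψ : ℝ → ℂ := fun r => if 0 < r then (φ (-Real.log r / M) : ℂ) else 0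
  obtain ⟨R, hR⟩ := hc.isBounded.subset_closedBall 0
  have hφ0 : ∀ y, φ y ≠ 0 → |y| ≤ R := fun y hy => by
    simpa using hR (subset_tsupport _ hy)
  have hΨ0 : ∀ r, Ψ r ≠ 0 → r ∈ Set.Icc (Real.exp (-(M * R))) (Real.exp (M * R)) := fun r hr => by
    have hr0 : 0 < r := by by_contra h; simp [Ψ, h] at hr
    have h1 : φ (-Real.log r / M) ≠ 0 := by simpa [Ψ, hr0] using hr
    have h2 := hφ0 _ h1
    rw [abs_div, abs_neg, abs_of_pos hM, div_le_iff₀ hM, abs_le] at h2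
    rw [← Real.exp_log hr0]
    exact ⟨Real.exp_le_exp.2 (by linarith), Real.exp_le_exp.2 (by linarith)⟩
  have hsupp : HasCompactSupport Ψ := HasCompactSupport.intro isCompact_Icc
    fun r hr => by_contra fun h => hr (hΨ0 r h)
  have hsmooth : ContDiff ℝ (⊤ : ℕ∞) Ψ := by
    rw [contDiff_iff_contDiffAt]
    intro r
    rcases lt_or_ge 0 r with hr | hr
    · have h1 : ContDiffAt ℝ (⊤ : ℕ∞) (fun r => (φ (-Real.log r / M) : ℂ)) r := by
        refine Complex.ofRealCLM.contDiff.contDiffAt.comp r (hφ.contDiffAt.comp r ?_)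
        exact ((Real.contDiffAt_log.2 hr.ne').neg).div_const M
      refine h1.congr_of_eventuallyEq ?_
      filter_upwards [lt_mem_nhds hr] with x hx
      simp [Ψ, hx]
    · refine (contDiffAt_const (c := (0 : ℂ))).congr_of_eventuallyEq ?_
      filter_upwards [gt_mem_nhds (hr.trans_lt (Real.exp_pos (-(M * R))))] with x hx
      by_contra h
      exact absurd (hΨ0 x h).1 (not_le.2 hx)
  refine ⟨hsupp.toSchwartzMap hsmooth, fun y => ?_⟩
  have : -Real.log (Real.exp (-M * y)) / M = y := by
    rw [Real.log_exp]; field_simp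
  show Ψ (Real.exp (-M * y)) = φ y
  simp only [Ψ, Real.exp_pos, if_true, this]

/-- In Fourier space, split the integrand as `m · (2πξ 𝓕Ψ) · (F / (2πξ m))` and use `ab ≤ (a² + b²)
/ 2`. The change of variable `k = -2π m² ξ` leaves a single factor `m` in both terms. -/
theorem norm_schwartz_comp_integral_le (hf : Integrable f) {X : ℝ → ℝ} (hX : Measurable X)
    (hL : Integrable fun k => ‖pulledFourier X f k‖ ^ 2 / k ^ 2) (Ψ : SchwartzMap ℝ ℂ) :
    ∃ C, ∀ m : ℝ, 0 < m → ‖∫ y, f y * Ψ (m ^ 2 * X y)‖ ≤ C * m := by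
  set Q : ℝ → ℝ := fun k => ‖pulledFourier X f k‖ ^ 2 / k ^ 2 with hQ
  set A : ℝ → ℝ := fun ξ => (2 * Real.pi * ξ) ^ 2 * ‖𝓕 Ψ ξ‖ ^ 2 with hA
  have hAint : Integrable A := by
    have h1 := (𝓕 Ψ).integrable_pow_mul volume 2
    have h2 := h1.bdd_mul (c := SchwartzMap.seminorm ℝ 0 0 (𝓕 Ψ)) (f := fun ξ => ‖𝓕 Ψ ξ‖)
      (𝓕 Ψ).continuous.norm.aestronglyMeasurable (by
        filter_upwards with ξ
        simpa using (𝓕 Ψ).norm_le_seminorm ℝ ξ)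
    refine (h2.const_mul ((2 * Real.pi) ^ 2)).congr ?_
    filter_upwards with ξ
    simp only [hA, Real.norm_eq_abs, sq_abs]
    ring
  refine ⟨√(2 * Real.pi) * (((∫ ξ, A ξ) + (2 * Real.pi)⁻¹ * ∫ k, Q k) / 2), fun m hm => ?_⟩
  have hne : -(2 * Real.pi * m ^ 2) ≠ 0 := by
    have := Real.pi_pos
    simp only [ne_eq, neg_eq_zero]; positivity
  have hQint : Integrable fun ξ => Q (-(2 * Real.pi * m ^ 2) * ξ) := hL.comp_mul_left' hne
  rw [integral_mul_schwartz_comp hf (hX.const_mul _) Ψ, norm_mul, Complex.norm_real,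
    Real.norm_of_nonneg (Real.sqrt_nonneg _), mul_assoc]
  gcongr
  calc _ ≤ ∫ ξ, (m * A ξ + m ^ 3 * Q (-(2 * Real.pi * m ^ 2) * ξ)) / 2 := by
        refine norm_integral_le_of_norm_le
          (((hAint.const_mul m).add (hQint.const_mul (m ^ 3))).div_const 2) ?_
        have h0 : ∀ᵐ ξ : ℝ, ξ ≠ 0 := by simp [ae_iff]
        filter_upwards [h0] with ξ hξ
        rw [pulledFourier_const_mul, norm_mul]
        simp only [hQ, hA]
        have h1 : m ^ 2 * -(2 * Real.pi * ξ) = -(2 * Real.pi * m ^ 2) * ξ := by ring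
        rw [h1]
        generalize ‖pulledFourier X f (-(2 * Real.pi * m ^ 2) * ξ)‖ = γ
        generalize ‖𝓕 Ψ ξ‖ = x
        have hd : 2 * Real.pi * ξ ≠ 0 := by
          have := Real.pi_ne_zero
          positivity
        have h2 : m ^ 3 * (γ ^ 2 / (-(2 * Real.pi * m ^ 2) * ξ) ^ 2) =
            m * (γ / (m * (2 * Real.pi * ξ))) ^ 2 := by
          field_simp
        have h3 : x * γ = m * ((2 * Real.pi * ξ) * x) * (γ / (m * (2 * Real.pi * ξ))) := by
          field_simp
        rw [h2, h3]
        nlinarith [mul_nonneg hm.le (sq_nonneg ((2 * Real.pi * ξ) * x -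
          γ / (m * (2 * Real.pi * ξ))))]
    _ = _ := by
        rw [integral_div, integral_add (hAint.const_mul m) (hQint.const_mul (m ^ 3)),
          integral_const_mul, integral_const_mul, Measure.integral_comp_mul_left, smul_eq_mul,
          abs_inv, abs_neg, abs_of_pos (by positivity)]
        field_simp

/-! ### Holomorphic extension from one-sided frequencies. -/

theorem norm_exp_two_pi_mul_le_one {ξ : ℝ} (hξ : ξ ≤ 0) {w : ℂ} (hw : 0 ≤ w.re) :
    ‖Complex.exp (2 * Real.pi * ξ * w)‖ ≤ 1 := by
  have : (2 * Real.pi * ξ * w : ℂ).re = 2 * Real.pi * ξ * w.re := by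
    rw [← Complex.re_ofReal_mul]; push_cast; rfl
  rw [Complex.norm_exp, Real.exp_le_one_iff, this]
  exact mul_nonpos_of_nonpos_of_nonneg (mul_nonpos_of_nonneg_of_nonpos (by positivity) hξ) hw

theorem diffContOnCl_laplace {a : ℝ → ℂ} (ha : Integrable a)
    (ha1 : Integrable fun ξ : ℝ => ‖ξ‖ * ‖a ξ‖) :
    DiffContOnCl ℂ (fun w => ∫ ξ in Set.Iic (0 : ℝ), a ξ * Complex.exp (2 * Real.pi * ξ * w))
      {z | 0 < z.re} := by
  have hmeas : ∀ w : ℂ, AEStronglyMeasurable (fun ξ : ℝ => a ξ * Complex.exp (2 * Real.pi * ξ * w))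
      (volume.restrict (Set.Iic 0)) := fun w =>
    (ha.1.mul (by fun_prop : Continuous fun ξ : ℝ =>
      Complex.exp (2 * Real.pi * ξ * w)).aestronglyMeasurable).restrict
  have hbd : ∀ w : ℂ, 0 ≤ w.re → ∀ᵐ ξ ∂(volume.restrict (Set.Iic (0 : ℝ))),
      ‖a ξ * Complex.exp (2 * Real.pi * ξ * w)‖ ≤ ‖a ξ‖ := fun w hw => by
    filter_upwards [ae_restrict_mem measurableSet_Iic] with ξ hξ
    rw [norm_mul]
    exact mul_le_of_le_one_right (norm_nonneg _) (norm_exp_two_pi_mul_le_one hξ hw)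
  have hopen : IsOpen {z : ℂ | 0 < z.re} := isOpen_lt continuous_const Complex.continuous_re
  refine ⟨fun w hw => DifferentiableAt.differentiableWithinAt ?_, ?_⟩
  · refine (hasDerivAt_integral_of_dominated_loc_of_deriv_le
      (F' := fun w ξ => a ξ * (Complex.exp (2 * Real.pi * ξ * w) * (2 * Real.pi * ξ)))
      (bound := fun ξ => 2 * Real.pi * (‖ξ‖ * ‖a ξ‖)) (hopen.mem_nhds hw)
      (Eventually.of_forall hmeas) (ha.norm.restrict.mono' (hmeas w) (hbd w (le_of_lt hw))) ?_ ?_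
      (ha1.const_mul _).restrict ?_).2.differentiableAt
    · exact (ha.1.mul (by fun_prop : Continuous fun ξ : ℝ => Complex.exp (2 * Real.pi * ξ * w) *
        (2 * Real.pi * ξ)).aestronglyMeasurable).restrict
    · filter_upwards [ae_restrict_mem measurableSet_Iic] with ξ hξ z hz
      have h1 : ‖(2 * Real.pi * ξ : ℂ)‖ = 2 * Real.pi * ‖ξ‖ := by
        simp [abs_of_pos Real.pi_pos]
      rw [norm_mul, norm_mul, h1]
      have := mul_le_mul_of_nonneg_right (norm_exp_two_pi_mul_le_one hξ (le_of_lt hz))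
        (mul_nonneg (norm_nonneg (a ξ)) (by positivity : 0 ≤ 2 * Real.pi * ‖ξ‖))
      linarith
    · filter_upwards with ξ z _
      simpa using ((hasDerivAt_id z).const_mul (2 * Real.pi * ξ : ℂ)).cexp.const_mul (a ξ)
  · rw [Complex.closure_setOfPred_lt_re]
    refine continuousOn_of_dominated (fun w _ => hmeas w) (fun w hw => hbd w hw)
      ha.norm.restrict ?_
    filter_upwards with ξ
    fun_prop

/-- Vanishing negative frequencies restrict the Fourier representation to `ξ ≤ 0`. The pairing with
`φ (y - t)` is thus a Laplace integral at `w = -t I`, bounded on `0 ≤ w.re`; decay as `t → -∞` is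
decay up the imaginary axis. -/
theorem integral_mul_eq_zero_of_fourier_neg (hf : Integrable f)
    (hneg : ∀ p < 0, pulledFourier id f p = 0) {c D : ℝ} (hc : 0 < c) (φ : SchwartzMap ℝ ℂ)
    (hdec : ∀ t, ‖∫ y, f y * φ (y - t)‖ ≤ D * Real.exp (c * t)) : ∫ y, f y * φ y = 0 := by
  let a : ℝ → ℂ := fun ξ => √(2 * Real.pi) * (𝓕 φ ξ * pulledFourier id f (-(2 * Real.pi * ξ)))
  have hcont := (continuous_pulledFourier hf measurable_id).comp
    (by fun_prop : Continuous fun ξ : ℝ => -(2 * Real.pi * ξ))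
  set B := (√(2 * Real.pi))⁻¹ * ∫ y, ‖f y‖ with hB
  have ha : Integrable a := by
    refine (((𝓕 φ).integrable (μ := volume)).mul_bdd (c := B) hcont.aestronglyMeasurable
      ?_).const_mul _
    filter_upwards with ξ using norm_pulledFourier_le _ _
  have ha1 : Integrable fun ξ : ℝ => ‖ξ‖ * ‖a ξ‖ := by
    have h1 := ((𝓕 φ).integrable_pow_mul volume 1).mul_bdd (c := B) hcont.norm.aestronglyMeasurable
      (by filter_upwards with ξ using (norm_norm _).trans_le (norm_pulledFourier_le _ _))
    refine (h1.const_mul √(2 * Real.pi)).congr ?_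
    filter_upwards with ξ
    simp only [a, norm_mul, Complex.norm_real, Function.comp,
      Real.norm_of_nonneg (Real.sqrt_nonneg _)]
    ring
  have hS : ∀ t : ℝ, ∫ y, f y * φ (y - t) =
      ∫ ξ in Set.Iic (0 : ℝ), a ξ * Complex.exp (2 * Real.pi * ξ * (-(t * Complex.I))) := by
    intro t
    rw [setIntegral_eq_integral_of_forall_compl_eq_zero,
      integral_mul_schwartz_comp hf (X := fun y => y - t) (by fun_prop), ← integral_const_mul]
    · congr 1
      ext ξ
      rw [show (fun y => y - t) = fun y => id y - t from rfl, pulledFourier_sub_const]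
      simp only [a]
      rw [mul_left_comm (𝓕 φ ξ), mul_left_comm (√(2 * Real.pi) : ℂ), mul_comm (Complex.exp _)]
      congr 2
      push_cast
      ring
    · intro ξ hξ
      have hξ' : -(2 * Real.pi * ξ) < 0 := by
        have := not_le.1 (Set.mem_Iic.not.1 hξ)
        have := Real.pi_pos
        simp only [Left.neg_neg_iff]
        positivity
      simp [a, hneg _ hξ']
  have h0 := eq_zero_of_exp_decay_on_imaginary_axis (diffContOnCl_laplace ha ha1)
    (C := ∫ ξ in Set.Iic (0 : ℝ), ‖a ξ‖) ?_ (D := D) hc ?_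
  · have := hS 0
    simp only [sub_zero, Complex.ofReal_zero, zero_mul, neg_zero] at this
    rw [this]
    exact h0
  · intro w hw
    refine norm_integral_le_of_norm_le ha.norm.restrict ?_
    filter_upwards [ae_restrict_mem measurableSet_Iic] with ξ hξ
    rw [norm_mul]
    exact mul_le_of_le_one_right (norm_nonneg _) (norm_exp_two_pi_mul_le_one hξ hw)
  · intro s _
    have := hdec (-s)
    rw [hS] at this
    simpa using this

end Fourier

/-! ### Infrared divergence -/

section Divergence

variable {f : ℝ → ℂ}

/-- An integrable function whose Fourier transform vanishes on the negative half-line, and whose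
image in the coordinate `exp (-M y)` has a square integrable antiderivative, is zero. -/
theorem ae_eq_zero_of_integrable_sq_div {M : ℝ} (hM : 0 < M) (hf : Integrable f)
    (hneg : ∀ p < 0, pulledFourier id f p = 0)
    (hL : Integrable fun k => ‖pulledFourier (fun y => Real.exp (-M * y)) f k‖ ^ 2 / k ^ 2) :
    f =ᵐ[volume] 0 := by
  refine ae_eq_zero_of_integral_contDiff_smul_eq_zero hf.locallyIntegrable fun φ hφ hc => ?_
  obtain ⟨Ψ, hΨ⟩ := exists_schwartz_comp_exp hM hφ hc
  obtain ⟨C, hC⟩ := norm_schwartz_comp_integral_le hf (by fun_prop) hL Ψ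
  have hc' : HasCompactSupport fun y => (φ y : ℂ) := hc.comp_left Complex.ofReal_zero
  have hφ' : ContDiff ℝ (⊤ : ℕ∞) fun y => (φ y : ℂ) := Complex.ofRealCLM.contDiff.comp hφ
  -- Translation by `t` is dilation of `r` by `m² = exp (M t)`, so the bound `C m` is `C exp (M t /
  -- 2)`.
  have := integral_mul_eq_zero_of_fourier_neg hf hneg (half_pos hM) (D := C)
    (hc'.toSchwartzMap hφ') fun t => by
      refine le_trans (le_of_eq ?_) (hC (Real.exp (M / 2 * t)) (Real.exp_pos _))
      congr 2
      ext y
      rw [← Real.exp_nat_mul, ← Real.exp_add]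
      have : (2 : ℕ) * (M / 2 * t) + -M * y = -M * (y - t) := by push_cast; ring
      rw [this, hΨ]
      rfl
  rw [← this]
  congr 1
  ext y
  rw [Complex.real_smul, mul_comm]
  rfl

/-- The shift by `Δ` is only a phase, and the reflection `x = Δ - r` flips the sign of `k`. -/
theorem norm_pulledFourier_relX (M Δ k : ℝ) :
    ‖pulledFourier (relX M Δ) f k‖ = ‖pulledFourier (fun y => Real.exp (-M * y)) f (-k)‖ := by
  have h : relX M Δ = fun y => (-1 * Real.exp (-M * y)) - -Δ := by
    ext y; simp only [relX]; ring
  rw [h, pulledFourier_sub_const (fun y => -1 * Real.exp (-M * y)),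
    pulledFourier_const_mul (fun y => Real.exp (-M * y)), norm_mul, neg_one_mul]
  rw [show Complex.I * k * ((-Δ : ℝ) : ℂ) = -(Complex.I * k * Δ) by push_cast; ring,
    norm_exp_neg_I_mul, one_mul]

/-- The spectral density of the thermal excess, up to a constant factor. -/
def excessDensity (X : ℝ → ℝ) (f : ℝ → ℂ) (β k : ℝ) : ℝ :=
  (‖pulledFourier X f k‖ ^ 2 + ‖pulledFourier X f (-k)‖ ^ 2) / k * (Real.exp (β * k) - 1)⁻¹

theorem exp_mul_sub_one_pos {β k : ℝ} (hβ : 0 < β) (hk : 0 < k) : 0 < Real.exp (β * k) - 1 := by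
  linarith [Real.add_one_lt_exp (mul_pos hβ hk).ne', mul_pos hβ hk]

theorem excessDensity_nonneg (X : ℝ → ℝ) {β k : ℝ} (hβ : 0 < β) (hk : 0 < k) :
    0 ≤ excessDensity X f β k := by
  have := exp_mul_sub_one_pos hβ hk
  unfold excessDensity
  positivity

theorem continuousOn_excessDensity (hf : Integrable f) {X : ℝ → ℝ} (hX : Measurable X) {β : ℝ}
    (hβ : 0 < β) : ContinuousOn (excessDensity X f β) (Set.Ioi 0) := by
  have h1 := continuous_pulledFourier hf hX
  refine ContinuousOn.mul (ContinuousOn.div (by fun_prop) (by fun_prop)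
    fun k hk => ne_of_gt hk) (ContinuousOn.inv₀ (by fun_prop) fun k hk => ?_)
  exact (exp_mul_sub_one_pos hβ hk).ne'

theorem sq_div_sq_le_excessDensity {β k a b : ℝ} (hβ : 0 < β) (hk : k ∈ Set.Ioc (0 : ℝ) 1) :
    a ^ 2 / k ^ 2 ≤ β * Real.exp β * ((a ^ 2 + b ^ 2) / k * (Real.exp (β * k) - 1)⁻¹) := by
  have hk0 : 0 < k := hk.1
  have h1 := exp_mul_sub_one_pos hβ hk0
  -- Multiply `1 - β k ≤ exp (-β k)` by `exp (β k)`, then use `k ≤ 1`.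
  have h2 : Real.exp (β * k) - 1 ≤ β * Real.exp β * k := by
    have h3 := Real.one_sub_le_exp_neg (β * k)
    have h4 : Real.exp (-(β * k)) * Real.exp (β * k) = 1 := by rw [← Real.exp_add]; simp
    have h5 : Real.exp (β * k) ≤ Real.exp β :=
      Real.exp_le_exp.2 (mul_le_of_le_one_right hβ.le hk.2)
    nlinarith [Real.exp_pos (β * k), mul_pos hβ hk0]
  have h6 : (β * Real.exp β * k)⁻¹ ≤ (Real.exp (β * k) - 1)⁻¹ := inv_anti₀ h1 h2
  calc a ^ 2 / k ^ 2 = β * Real.exp β * (a ^ 2 / k * (β * Real.exp β * k)⁻¹) := by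
        field_simp
    _ ≤ _ := by
        gcongr
        nlinarith [sq_nonneg b]

/-- Only `k → 0` matters: beyond `1` the integrand is at most `B² / k²`. -/
theorem integrableOn_sq_div_sq {F : ℝ → ℂ} (hF : Continuous F) {B : ℝ} (hB : ∀ k, ‖F k‖ ≤ B)
    (h : IntegrableOn (fun k => ‖F k‖ ^ 2 / k ^ 2) (Set.Ioc 0 1)) :
    IntegrableOn (fun k => ‖F k‖ ^ 2 / k ^ 2) (Set.Ioi 0) := by
  rw [← Set.Ioc_union_Ioi_eq_Ioi zero_le_one]
  refine h.union (((integrableOn_Ioi_rpow_of_lt (a := -2) (by norm_num) one_pos).const_mul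
    (B ^ 2)).mono' ?_ ?_)
  · exact (by fun_prop : Measurable fun k => ‖F k‖ ^ 2 / k ^ 2).aestronglyMeasurable
  · filter_upwards [ae_restrict_mem measurableSet_Ioi] with k hk
    have hk0 : (0 : ℝ) < k := zero_lt_one.trans hk
    rw [Real.norm_of_nonneg (by positivity), Real.rpow_neg hk0.le, ← div_eq_mul_inv]
    have : k ^ (2 : ℝ) = k ^ 2 := by exact_mod_cast Real.rpow_natCast k 2
    rw [this]
    gcongr
    exact hB k

theorem lintegral_excessDensity {M Δ β : ℝ} (hM : 0 < M) (hβ : 0 < β) (hf : Integrable f)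
    (hneg : ∀ p < 0, pulledFourier id f p = 0) (hne : ¬ f =ᵐ[volume] 0) :
    ∫⁻ k in Set.Ioc 0 1, ENNReal.ofReal (excessDensity (relX M Δ) f β k) = ⊤ := by
  by_contra htop
  have hX : Measurable (relX M Δ) := by unfold relX; fun_prop
  have hF := continuous_pulledFourier hf hX
  have hpos : 0 ≤ᵐ[volume.restrict (Set.Ioc 0 1)] excessDensity (relX M Δ) f β := by
    filter_upwards [ae_restrict_mem measurableSet_Ioc] with k hk
    exact excessDensity_nonneg _ hβ hk.1
  have hmeas : AEStronglyMeasurable (excessDensity (relX M Δ) f β)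
      (volume.restrict (Set.Ioc 0 1)) :=
    ((continuousOn_excessDensity hf hX hβ).mono Set.Ioc_subset_Ioi_self).aestronglyMeasurable
      measurableSet_Ioc
  have hint : IntegrableOn (excessDensity (relX M Δ) f β) (Set.Ioc 0 1) :=
    (lintegral_ofReal_ne_top_iff_integrable hmeas hpos).1 htop
  have hint' := hint.const_mul (β * Real.exp β)
  have h1 : IntegrableOn (fun k => ‖pulledFourier (relX M Δ) f k‖ ^ 2 / k ^ 2) (Set.Ioi 0) := by
    refine integrableOn_sq_div_sq hF (norm_pulledFourier_le _) (hint'.mono' ?_ ?_)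
    · exact (by fun_prop : Measurable fun k =>
        ‖pulledFourier (relX M Δ) f k‖ ^ 2 / k ^ 2).aestronglyMeasurable
    · filter_upwards [ae_restrict_mem measurableSet_Ioc] with k hk
      rw [Real.norm_of_nonneg (by positivity)]
      exact sq_div_sq_le_excessDensity hβ hk
  have h2 : IntegrableOn (fun k => ‖pulledFourier (relX M Δ) f (-k)‖ ^ 2 / k ^ 2)
      (Set.Ioi 0) := by
    refine integrableOn_sq_div_sq (hF.comp continuous_neg) (fun k => norm_pulledFourier_le _ _)
      (hint'.mono' ?_ ?_)
    · exact (by fun_prop : Measurable fun k =>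
        ‖pulledFourier (relX M Δ) f (-k)‖ ^ 2 / k ^ 2).aestronglyMeasurable
    · filter_upwards [ae_restrict_mem measurableSet_Ioc] with k hk
      rw [Real.norm_of_nonneg (by positivity), excessDensity, add_comm (_ ^ 2)]
      exact sq_div_sq_le_excessDensity hβ hk
  refine hne (ae_eq_zero_of_integrable_sq_div hM hf hneg ?_)
  simp only [norm_pulledFourier_relX, neg_neg] at h1 h2
  rw [← integrableOn_univ, ← Set.Iic_union_Ioi (a := (0 : ℝ))]
  refine IntegrableOn.union ?_ h2
  rw [integrableOn_Iic_iff_integrableOn_Iio]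
  rw [← neg_zero] at h1
  simpa using h1.comp_neg_Iio

/-! ### Riemann sums over the box momenta. -/

theorem momentum_pos {L : ℝ} (hL : 0 < L) (j : ℕ) : 0 < momentum L j := by
  have := Real.pi_pos
  unfold momentum
  positivity

/-- Riemann sums over the momenta of the box diverge if the integral does. -/
theorem tendsto_sum_momentum_atTop {h : ℝ → ℝ} (hc : ContinuousOn h (Set.Ioi 0))
    (h0 : ∀ k, 0 < k → 0 ≤ h k) (htop : ∫⁻ k in Set.Ioc 0 1, ENNReal.ofReal (h k) = ⊤) :
    Tendsto (fun c : ℝ × ℝ =>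
      2 * Real.pi / c.1 * ∑ j ∈ Finset.range (modeCount c.1 c.2), h (momentum c.1 j))
      cutoffRemoval atTop := by
  have hπ := Real.pi_pos
  -- Step function taking on each cell of width `2π / L` the value of `h` at the right endpoint; its
  -- full integral is the Riemann sum.
  let g : ℝ × ℝ → ℝ → ENNReal := fun c k => ∑ j ∈ Finset.range (modeCount c.1 c.2),
    (Set.Ioc (momentum c.1 j - 2 * Real.pi / c.1) (momentum c.1 j)).indicator
      (fun _ => ENNReal.ofReal (h (momentum c.1 j))) k
  have hgm : ∀ c, Measurable (g c) := fun c =>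
    Finset.measurable_fun_sum _ fun j _ => measurable_const.indicator measurableSet_Ioc
  have hL : ∀ B, ∀ᶠ c : ℝ × ℝ in cutoffRemoval, B ≤ c.1 := fun B =>
    tendsto_fst.eventually (eventually_ge_atTop B)
  have hΛ : ∀ᶠ c : ℝ × ℝ in cutoffRemoval, 2 ≤ c.2 :=
    tendsto_snd.eventually (eventually_ge_atTop 2)
  have hcg : cutoffRemoval.IsCountablyGenerated := by unfold cutoffRemoval; infer_instance
  have hne : cutoffRemoval.NeBot := by unfold cutoffRemoval; infer_instance
  have hgint : ∀ᶠ c in cutoffRemoval, ∫⁻ k in Set.Ioc 0 1, g c k ≤ ENNReal.ofReal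
      (2 * Real.pi / c.1 * ∑ j ∈ Finset.range (modeCount c.1 c.2), h (momentum c.1 j)) := by
    filter_upwards [hL 1] with c hc1
    have hc0 : 0 < c.1 := by linarith
    refine (lintegral_mono' Measure.restrict_le_self le_rfl).trans (le_of_eq ?_)
    rw [lintegral_finsetSum _ fun j _ => measurable_const.indicator measurableSet_Ioc,
      Finset.mul_sum, ENNReal.ofReal_sum_of_nonneg
        fun j _ => mul_nonneg (by positivity) (h0 _ (momentum_pos hc0 j))]
    refine Finset.sum_congr rfl fun j _ => ?_
    rw [lintegral_indicator_const measurableSet_Ioc, Real.volume_Ioc, sub_sub_cancel, mul_comm,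
      ENNReal.ofReal_mul (by positivity)]
  have hlim : ∀ k ∈ Set.Ioc (0 : ℝ) 1,
      ENNReal.ofReal (h k) ≤ liminf (fun c => g c k) cutoffRemoval := by
    intro k hk
    -- Index of the cell containing `k`; the `- 1` is there because mode `j` has momentum `2π (j +
    -- 1) / L`.
    let J : ℝ × ℝ → ℕ := fun c => ⌈k * c.1 / (2 * Real.pi)⌉₊ - 1
    have hJ : ∀ᶠ c : ℝ × ℝ in cutoffRemoval, k ≤ momentum c.1 (J c) ∧
        momentum c.1 (J c) < k + 2 * Real.pi / c.1 ∧ J c < modeCount c.1 c.2 := by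
      -- With `k ≤ 1`, these bounds give `k L + 2π ≤ Λ L`, so the cell of `k` lies below the cutoff.
      filter_upwards [hL (2 * Real.pi), hΛ] with c hc1 hc2
      have hc0 : 0 < c.1 := by linarith
      set x := k * c.1 / (2 * Real.pi) with hx
      have hx0 : 0 < x := div_pos (mul_pos hk.1 hc0) (by positivity)
      have hceil : 0 < ⌈x⌉₊ := Nat.ceil_pos.2 hx0
      have hmom : momentum c.1 (J c) = 2 * Real.pi * ⌈x⌉₊ / c.1 := by
        have : ((J c : ℕ) : ℝ) + 1 = ⌈x⌉₊ := by
          have : J c + 1 = ⌈x⌉₊ := Nat.sub_add_cancel hceil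
          exact_mod_cast this
        rw [momentum, this]
      have hk' : k = 2 * Real.pi * x / c.1 := by rw [hx]; field_simp
      refine ⟨?_, ?_, ?_⟩
      · rw [hmom, hk']
        gcongr
        exact Nat.le_ceil x
      · rw [hmom, hk', ← add_div]
        gcongr
        nlinarith [Nat.ceil_lt_add_one hx0.le]
      · have : ⌈x⌉₊ ≤ modeCount c.1 c.2 := by
          refine Nat.le_floor ((Nat.ceil_lt_add_one hx0.le).le.trans ?_)
          rw [hx, div_add_one (by positivity)]
          gcongr
          nlinarith [hk.2]
        exact lt_of_lt_of_le (Nat.sub_lt hceil one_pos) this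
    have hJlim : Tendsto (fun c : ℝ × ℝ => momentum c.1 (J c)) cutoffRemoval (𝓝 k) := by
      have h1 : Tendsto (fun c : ℝ × ℝ => k + 2 * Real.pi / c.1) cutoffRemoval (𝓝 (k + 0)) :=
        (tendsto_fst.const_div_atTop (2 * Real.pi)).const_add k
      rw [add_zero] at h1
      exact tendsto_of_tendsto_of_tendsto_of_le_of_le' tendsto_const_nhds h1
        (hJ.mono fun c h => h.1) (hJ.mono fun c h => h.2.1.le)
    have hh : Tendsto (fun c : ℝ × ℝ => ENNReal.ofReal (h (momentum c.1 (J c)))) cutoffRemoval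
        (𝓝 (ENNReal.ofReal (h k))) :=
      ENNReal.tendsto_ofReal (((hc.continuousAt (Ioi_mem_nhds hk.1)).tendsto).comp hJlim)
    rw [← hh.liminf_eq]
    refine liminf_le_liminf (hJ.mono fun c hcJ => ?_)
    have hmem : k ∈ Set.Ioc (momentum c.1 (J c) - 2 * Real.pi / c.1) (momentum c.1 (J c)) :=
      ⟨by linarith [hcJ.2.1], hcJ.1⟩
    calc ENNReal.ofReal (h (momentum c.1 (J c)))
        = (Set.Ioc (momentum c.1 (J c) - 2 * Real.pi / c.1) (momentum c.1 (J c))).indicator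
          (fun _ => ENNReal.ofReal (h (momentum c.1 (J c)))) k := by
          rw [Set.indicator_of_mem hmem]
      _ ≤ g c k := Finset.single_le_sum
          (f := fun j => (Set.Ioc (momentum c.1 j - 2 * Real.pi / c.1) (momentum c.1 j)).indicator
            (fun _ => ENNReal.ofReal (h (momentum c.1 j))) k)
          (fun _ _ => zero_le) (Finset.mem_range.2 hcJ.2.2)
  -- Fatou along the countably generated filter `cutoffRemoval`: a lower bound suffices, so no
  -- uniformity near `0` is needed.
  have hfatou : liminf (fun c => ∫⁻ k in Set.Ioc 0 1, g c k) cutoffRemoval = ⊤ := by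
    rw [eq_top_iff, ← htop]
    refine (setLIntegral_mono' measurableSet_Ioc hlim).trans (lintegral_liminf_le hgm)
  refine tendsto_atTop.2 fun B => ?_
  have hB := eventually_lt_of_lt_liminf (show ENNReal.ofReal B <
    liminf (fun c => ∫⁻ k in Set.Ioc 0 1, g c k) cutoffRemoval by
      rw [hfatou]; exact ENNReal.ofReal_lt_top)
  filter_upwards [hB, hgint] with c h1 h2
  by_contra hlt
  exact absurd (h1.trans_le h2) (not_lt.2 (ENNReal.ofReal_le_ofReal (not_le.1 hlt).le))

end Divergence

/-! ### The thermal excess in the box -/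

section Box

variable {X : ℝ → ℝ} {f : ℝ → ℂ}

theorem norm_coeffA_sq {L : ℝ} (hL : 0 < L) (j : ℕ) :
    ‖coeffA X f L j‖ ^ 2 =
      Real.pi / L * (‖pulledFourier X f (momentum L j)‖ ^ 2 / momentum L j) := by
  have hk := momentum_pos hL j
  have hπ := Real.pi_pos
  rw [coeffA, pulledFourier]
  simp only [mul_comm (f _)]
  rw [norm_mul, norm_mul, mul_pow, mul_pow, Complex.norm_real, Complex.norm_real,
    norm_inv, norm_inv, Real.norm_of_nonneg (Real.sqrt_nonneg _),
    Real.norm_of_nonneg (Real.sqrt_nonneg _), inv_pow, inv_pow, Real.sq_sqrt (by positivity),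
    Real.sq_sqrt (by positivity)]
  field_simp

theorem norm_coeffB_sq {L : ℝ} (hL : 0 < L) (j : ℕ) :
    ‖coeffB X f L j‖ ^ 2 =
      Real.pi / L * (‖pulledFourier X f (-momentum L j)‖ ^ 2 / momentum L j) := by
  have hk := momentum_pos hL j
  have hπ := Real.pi_pos
  rw [coeffB, pulledFourier]
  simp only [mul_comm (f _), Complex.ofReal_neg, mul_neg, neg_mul, neg_neg]
  rw [norm_mul, norm_mul, mul_pow, mul_pow, Complex.norm_real, Complex.norm_real,
    norm_inv, norm_inv, Real.norm_of_nonneg (Real.sqrt_nonneg _),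
    Real.norm_of_nonneg (Real.sqrt_nonneg _), inv_pow, inv_pow, Real.sq_sqrt (by positivity),
    Real.sq_sqrt (by positivity)]
  field_simp

theorem vacuumNumber_nonneg (s : ScalarField) (X : ℝ → ℝ) (f : ℝ → ℂ) (L Λ : ℝ) :
    0 ≤ vacuumNumber s X f L Λ := by
  cases s <;> simp only [vacuumNumber, numberOpReal, numberOpComplex, vacuumMean_fieldSquare] <;>
    positivity

/-- The real and complex fields have the same excess: each mode contributes `|coeffA|² + |coeffB|²`,
from one oscillator or from two. -/
theorem thermalNumber_sub_vacuumNumber (s : ScalarField) {β L : ℝ} (hβ : 0 < β) (hL : 0 < L)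
    (Λ : ℝ) : thermalNumber s X f β L Λ - vacuumNumber s X f L Λ =
      Real.pi / L * ∑ j ∈ Finset.range (modeCount L Λ), excessDensity X f β (momentum L j) := by
  have key : ∑ j : Fin (modeCount L Λ), (‖coeffA X f L j‖ ^ 2 + ‖coeffB X f L j‖ ^ 2) *
      (Real.exp (β * momentum L j) - 1)⁻¹ =
      Real.pi / L * ∑ j ∈ Finset.range (modeCount L Λ), excessDensity X f β (momentum L j) := by
    rw [Finset.mul_sum, Finset.sum_range]
    refine Finset.sum_congr rfl fun j _ => ?_
    rw [norm_coeffA_sq hL, norm_coeffB_sq hL, excessDensity]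
    ring
  rw [← key]
  cases s
  · simp only [thermalNumber, vacuumNumber, numberOpReal]
    rw [gibbsMean_fieldSquare hβ fun j => momentum_pos hL _, vacuumMean_fieldSquare]
    ring
  · simp only [thermalNumber, vacuumNumber, numberOpComplex]
    rw [gibbsMean_fieldSquare hβ (by rintro (j | j) <;> exact momentum_pos hL _),
      vacuumMean_fieldSquare, add_sub_cancel_left]
    simp [Fintype.sum_sum_type, add_mul, Finset.sum_add_distrib]

end Box

/-! ### Removal of the cutoffs and conclusion. -/

theorem tendsto_excess_atTop (s : ScalarField) {M Δ β : ℝ} (hM : 0 < M) (hβ : 0 < β)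
    {f : ℝ → ℂ} (hf : Integrable f) (hneg : ∀ p < 0, pulledFourier id f p = 0)
    (hne : ¬ f =ᵐ[volume] 0) :
    Tendsto (fun c : ℝ × ℝ => thermalNumber s (relX M Δ) f β c.1 c.2 -
      vacuumNumber s (relX M Δ) f c.1 c.2) cutoffRemoval atTop := by
  have hX : Measurable (relX M Δ) := by unfold relX; fun_prop
  have h := (tendsto_sum_momentum_atTop (continuousOn_excessDensity hf hX hβ)
    (fun k hk => excessDensity_nonneg _ hβ hk)
    -- The factor `1 / 2` turns the cell width `2π / L` into the prefactor `π / L`.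
    (lintegral_excessDensity hM hβ hf hneg hne)).const_mul_atTop (half_pos one_pos)
  refine h.congr' ?_
  filter_upwards [tendsto_fst.eventually (eventually_gt_atTop 0)] with c hc
  rw [thermalNumber_sub_vacuumNumber s hβ hc]
  ring

theorem IsPositionSpaceFunction.not_ae_eq_zero {ft : Lp ℂ 2 waveMeasure} {f : ℝ → ℂ}
    (hf : IsPositionSpaceFunction ft f) (hnorm : ‖ft‖ = 1) : ¬ f =ᵐ[volume] 0 := by
  intro h
  have hF : ∀ p, pulledFourier id f p = 0 := fun p => by
    have : ∫ y, Complex.exp (-(Complex.I * p * (id y : ℝ))) * f y = 0 :=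
      integral_eq_zero_of_ae (h.mono fun y hy => by simp [hy])
    rw [pulledFourier, this, mul_zero]
  have h0 : ft = 0 := by
    rw [Lp.eq_zero_iff_ae_eq_zero]
    filter_upwards [hf.fourier_pos] with p hp
    rw [← hp, hF p, Pi.zero_apply]
  simp [h0] at hnorm

end RelBH

end

theorem mainTheorem4 (s : RelBH.ScalarField) (M Δ : ℝ) (hM : 0 < M)
    (ft : MeasureTheory.Lp ℂ 2 RelBH.waveMeasure) (hnorm : ‖ft‖ = 1)
    (f : ℝ → ℂ) (hf : RelBH.IsPositionSpaceFunction ft f) (β : ℝ) (hβ : 0 < β) :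
    RelBH.ExcessNumberEq s (RelBH.relX M Δ) f β ⊤ ∧
    (RelBH.spontaneousNumber (RelBH.relX M Δ) f ≠ ⊤ →
      Filter.Tendsto
        (fun c : ℝ × ℝ => RelBH.thermalNumber s (RelBH.relX M Δ) f β c.1 c.2 -
          (RelBH.spontaneousNumber (RelBH.relX M Δ) f).toReal)
        RelBH.cutoffRemoval Filter.atTop) ∧
    RelBH.ThermalNumberEq s (RelBH.relX M Δ) f β ⊤ ∧
    (∀ β' : ℝ, 0 < β' → RelBH.outgoingThermalNumber β' ft ≠ ⊤ →
      Filter.Tendsto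
        (fun c : ℝ × ℝ => RelBH.thermalNumber s (RelBH.relX M Δ) f β c.1 c.2 -
          (RelBH.outgoingThermalNumber β' ft).toReal)
        RelBH.cutoffRemoval Filter.atTop) := by
  have hexc := RelBH.tendsto_excess_atTop s (Δ := Δ) hM hβ hf.integrable hf.fourier_neg
    (hf.not_ae_eq_zero hnorm)
  have hth : Tendsto (fun c : ℝ × ℝ => RelBH.thermalNumber s (RelBH.relX M Δ) f β c.1 c.2)
      RelBH.cutoffRemoval atTop :=
    -- The vacuum mean is nonnegative, so the thermal mean dominates the excess; the remaining
    -- claims subtract a finite constant.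
    tendsto_atTop_mono (fun c => sub_le_self _ (RelBH.vacuumNumber_nonneg s _ f c.1 c.2)) hexc
  exact ⟨EReal.tendsto_coe_nhds_top_iff.2 hexc,
    fun _ => tendsto_atTop_add_const_right _ _ hth, EReal.tendsto_coe_nhds_top_iff.2 hth,
    fun _ _ _ => tendsto_atTop_add_const_right _ _ hth⟩
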